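/- Let $n\ge 0$ be an integer and $\delta\ge 0$ a real number. A $\delta$-hyperbolic space is a nonempty geodesic metric space $\mathcal H$ in which all geodesic triangles are $\delta$-thin: for all points $r,p,q$ and all geodesics $[r,p]$, $[r,q]$ parametrized by arc length from $r$ as $p(t)$, $q(t)$, one has $|p(t)-q(t)|\le\delta$ for $0\le t\le\frac12(|p-r|+|q-r|-|p-q|)$. Let $G$ be a group that has a presentation with $n$ relators (the set of generators may be arbitrary), and suppose that $G$ acts by isometries on a $\delta$-hyperbolic space $\mathcal H$ with minimal displacement $$\inf_{g\in G\setminus\{1\},\ p\in\mathcal H}|g\cdot p-p|>(2n+11)^2\delta .$$ Then $G$ has cohomological dimension at most $2$; that is, the trivial module $\mathbb Z$ has a free $\mathbb Z[G]$-resolution $0\to F_2\to F_1\to F_0\to\mathbb Z\to 0$. (For the trivial group the infimum is read as $+\infty$.) -/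

import Mathlib

universe u w

namespace FewRelator

section Hyperbolic

variable {X : Type w} [MetricSpace X]

/-- The Gromov product `⟨p, q⟩_r = (|p - r| + |q - r| - |p - q|) / 2`. -/
noncomputable def gromovProduct (p q r : X) : ℝ :=
  (dist p r + dist q r - dist p q) / 2

/-- `γ`, restricted to `[0, |p - q|]`, is a geodesic segment from `p` to `q` parametrized by
arc length. The values of `γ` outside of that interval are irrelevant. -/
def IsGeodesicSegment (γ : ℝ → X) (p q : X) : Prop :=
  γ 0 = p ∧ γ (dist p q) = q ∧
    ∀ s ∈ Set.Icc 0 (dist p q), ∀ t ∈ Set.Icc 0 (dist p q), dist (γ s) (γ t) = |s - t|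

/-- A geodesic metric space all of whose geodesic triangles are `δ`-thin: any two geodesics
`[r, p]` and `[r, q]`, parametrized by arc length from `r`, stay `δ`-close up to time
`⟨p, q⟩_r`. -/
def IsHyperbolic (δ : ℝ) (X : Type w) [MetricSpace X] : Prop :=
  (∀ p q : X, ∃ γ : ℝ → X, IsGeodesicSegment γ p q) ∧
  ∀ (r p q : X) (γ₁ γ₂ : ℝ → X), IsGeodesicSegment γ₁ r p → IsGeodesicSegment γ₂ r q →
    ∀ t : ℝ, 0 ≤ t → t ≤ gromovProduct p q r → dist (γ₁ t) (γ₂ t) ≤ δ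

/-- The minimal displacement of an action: the infimum of `|g p - p|` over all `g ≠ 1` and all
points `p` (it is `∞` for the trivial group). -/
noncomputable def displacement (G : Type u) [Group G] (X : Type w) [MetricSpace X]
    [MulAction G X] : ENNReal :=
  ⨅ (g : G) (_ : g ≠ 1) (p : X), edist (g • p) p

/-- The group `G` acts by isometries on some nonempty `δ`-hyperbolic space with minimal
displacement greater than `(2 n + 11)² δ`. -/
def HypothesisH (n : ℕ) (δ : ℝ) (G : Type u) [Group G] : Prop :=
  0 ≤ δ ∧ ∃ (X : Type w) (_ : MetricSpace X) (_ : Nonempty X) (_ : MulAction G X),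
    IsIsometricSMul G X ∧ IsHyperbolic δ X ∧
      ENNReal.ofReal ((2 * (n : ℝ) + 11) ^ 2 * δ) < displacement G X

end Hyperbolic

/-- `G` has a presentation with `n` relators, on an arbitrary set of generators. (A set of
generators of such a presentation of `G : Type u` always has a copy in `Type u`, because it is
either finite or of the cardinality of `G`.) -/
def IsRelatorGroup (n : ℕ) (G : Type u) [Group G] : Prop :=
  ∃ (α : Type u) (r : Fin n → FreeGroup α), Nonempty (G ≃* PresentedGroup (Set.range r))

/-- A free `ℤ[G]`-resolution
`0 → F_d → ⋯ → F_1 → F_0 → ℤ → 0` of the trivial module `ℤ`, of length at most `d`. -/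
structure FreeResolution (G : Type u) [Group G] (d : ℕ) where
  F : ℕ → Type u
  [addCommGroup : ∀ k, AddCommGroup (F k)]
  [module : ∀ k, Module (MonoidAlgebra ℤ G) (F k)]
  [free : ∀ k, Module.Free (MonoidAlgebra ℤ G) (F k)]
  /-- the boundary maps -/
  bd : ∀ k, F (k + 1) →ₗ[MonoidAlgebra ℤ G] F k
  /-- the augmentation -/
  aug : F 0 →ₗ[MonoidAlgebra ℤ G] (Representation.trivial ℤ G ℤ).asModule
  aug_surjective : Function.Surjective aug
  exact_zero : Function.Exact (bd 0) aug
  exact_succ : ∀ k, Function.Exact (bd (k + 1)) (bd k)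
  length_le : ∀ k, d < k → Subsingleton (F k)

/-- The cohomological dimension of `G`: the minimal length of a free `ℤ[G]`-resolution of `ℤ`
(`∞` if there is no such resolution of finite length). -/
noncomputable def cohomologicalDimension (G : Type u) [Group G] : ℕ∞ :=
  ⨅ (d : ℕ) (_ : Nonempty (FreeResolution G d)), (d : ℕ∞)

end FewRelator

/-! A presentation gives the Fox boundary `foxBoundary` from a free module to `ℤ[G]`. By
`ker_foxBoundary` its kernel `M` is generated by the Fox derivatives of the `n` relators, so a free
resolution of length two exists as soon as `M` is free. `M` is pure, because `ℤ[G]` has no additive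
torsion, and `free_of_pure` shows that under large displacement a pure submodule with `n` generators
is free.

The engine is an elimination. Supports are placed in `X` through the orbit of a base point and
enclosed in balls. A relation `∑ μ i • a i = 0` yields finitely many translates of the supports of
the `a i`, of at most `n` types, and translates of one type are far apart because displacement is
large. As in a tree, sets chained together by overlaps far from the base point are all seen in the
same direction (`Linked.le_gromovProduct`). This produces a cluster in which some type `j` occurs
once (`exists_cluster`). Restricting the relation to the cluster gives a combination whose far part
cancels and whose near part fits in a smaller ball than that of `a j`, with a single group element
as coefficient of `a j` (`exists_shrinking_combination`). Replacing `a j` by it shrinks a radius by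
`δ`, so the process stops, with the nonzero elements independent
(`exists_linearIndependent_ne_zero`).

Over `ℤ` the coefficient of `a j` is an integer that need not be a unit, so elimination only gives a
free submodule containing `N • M` for some `N ≠ 0`. The primes of `N` are then removed one at a time
by elimination over `ZMod p`, where coefficients can be normalized to one
(`exists_linearIndependent_of_prime_mul`). -/

namespace FewRelator

/-! ### Gromov products and thin triangles -/

section Geometry

variable {X : Type w} [MetricSpace X] {δ : ℝ}

lemma IsHyperbolic.mono {δ' : ℝ} (h : IsHyperbolic δ X) (hle : δ ≤ δ') : IsHyperbolic δ' X :=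
  ⟨h.1, fun r p q γ₁ γ₂ h₁ h₂ t h0 ht => (h.2 r p q γ₁ γ₂ h₁ h₂ t h0 ht).trans hle⟩

lemma gromovProduct_comm (p q r : X) : gromovProduct p q r = gromovProduct q p r := by
  unfold gromovProduct; rw [dist_comm p q]; ring

lemma gromovProduct_nonneg (p q r : X) : 0 ≤ gromovProduct p q r := by
  unfold gromovProduct; linarith [dist_triangle_right p q r]

lemma gromovProduct_le_left (p q r : X) : gromovProduct p q r ≤ dist r p := by
  unfold gromovProduct; linarith [dist_triangle_left q r p, dist_comm p r, dist_comm q r]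

lemma gromovProduct_le_right (p q r : X) : gromovProduct p q r ≤ dist r q := by
  rw [gromovProduct_comm]; exact gromovProduct_le_left q p r

lemma gromovProduct_self (p r : X) : gromovProduct p p r = dist r p := by
  unfold gromovProduct; rw [dist_self, dist_comm p r]; ring

lemma IsGeodesicSegment.dist_right {γ : ℝ → X} {p q : X} (h : IsGeodesicSegment γ p q) {t : ℝ}
    (h0 : 0 ≤ t) (ht : t ≤ dist p q) : dist (γ t) q = dist p q - t := by
  have := h.2.2 t ⟨h0, ht⟩ (dist p q) ⟨dist_nonneg, le_rfl⟩
  rw [h.2.1] at this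
  rw [this, abs_sub_comm, abs_of_nonneg (sub_nonneg.2 ht)]

lemma IsGeodesicSegment.reverse {γ : ℝ → X} {p q : X} (h : IsGeodesicSegment γ p q) :
    IsGeodesicSegment (fun t => γ (dist p q - t)) q p := by
  refine ⟨by simpa using h.2.1, by simpa [dist_comm q p] using h.1, fun s hs t ht => ?_⟩
  rw [dist_comm q p] at hs ht
  rw [h.2.2 _ ⟨by linarith [hs.2], by linarith [hs.1]⟩ _ ⟨by linarith [ht.2], by linarith [ht.1]⟩,
    abs_sub_comm]
  congr 1
  ring

/-- Gromov's four point condition. -/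
lemma IsHyperbolic.min_sub_le_gromovProduct (h : IsHyperbolic δ X) (x y z b : X) :
    min (gromovProduct x z b) (gromovProduct z y b) - δ ≤ gromovProduct x y b := by
  obtain ⟨γx, hx⟩ := h.1 b x
  obtain ⟨γy, hy⟩ := h.1 b y
  obtain ⟨γz, hz⟩ := h.1 b z
  -- At time `t` the geodesics to `x` and `y` are `2 * δ`-close, via the one to `z`; the Gromov
  -- product halves this error.
  set t := min (gromovProduct x z b) (gromovProduct z y b) with ht
  have h0 : 0 ≤ t := le_min (gromovProduct_nonneg _ _ _) (gromovProduct_nonneg _ _ _)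
  have h1 := h.2 b x z γx γz hx hz t h0 (min_le_left _ _)
  have h2 := h.2 b z y γz γy hz hy t h0 (min_le_right _ _)
  have h3 := hx.dist_right h0 ((min_le_left _ _).trans (gromovProduct_le_left _ _ _))
  have h4 := hy.dist_right h0 ((min_le_right _ _).trans (gromovProduct_le_right _ _ _))
  have h5 := dist_triangle4 x (γx t) (γy t) y
  have h6 := dist_triangle (γx t) (γz t) (γy t)
  rw [dist_comm x (γx t)] at h5
  unfold gromovProduct
  linarith [dist_comm x b, dist_comm y b]

lemma IsHyperbolic.le_gromovProduct_trans (h : IsHyperbolic δ X) {x y z b : X} {s : ℝ}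
    (h₁ : s ≤ gromovProduct x z b) (h₂ : s ≤ gromovProduct z y b) :
    s - δ ≤ gromovProduct x y b :=
  (sub_le_sub_right (le_min h₁ h₂) δ).trans (h.min_sub_le_gromovProduct x y z b)

/-- The distance function to a point is almost convex along geodesics, as in a tree. -/
lemma IsHyperbolic.dist_geodesic_le (h : IsHyperbolic δ X) {b x : X} {γ : ℝ → X}
    (hγ : IsGeodesicSegment γ b x) {t : ℝ} (h0 : 0 ≤ t) (ht : t ≤ dist b x) (z : X) :
    dist (γ t) z ≤ max (dist b z - t) (dist x z - (dist b x - t)) + δ := by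
  obtain ⟨γz, hz⟩ := h.1 b z
  obtain ⟨γ', hγ'⟩ := h.1 x z
  -- Up to the branch point `γ` follows `[b, z]`; beyond it, `γ` read backwards from `x` follows
  -- `[x, z]`.
  rcases le_total t (gromovProduct x z b) with hc | hc
  · have h1 := h.2 b x z γ γz hγ hz t h0 hc
    have h2 := hz.dist_right h0 (hc.trans (gromovProduct_le_right _ _ _))
    linarith [dist_triangle (γ t) (γz t) z, le_max_left (dist b z - t) (dist x z - (dist b x - t))]
  · have h0' : 0 ≤ dist b x - t := sub_nonneg.2 ht
    have hc' : dist b x - t ≤ gromovProduct b z x := by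
      unfold gromovProduct at hc ⊢
      linarith [dist_comm x b, dist_comm z b, dist_comm x z]
    have h1 := h.2 x b z _ γ' hγ.reverse hγ' _ h0' hc'
    have h2 := hγ'.dist_right h0' (hc'.trans (gromovProduct_le_right _ _ _))
    rw [sub_sub_cancel] at h1
    linarith [dist_triangle (γ t) (γ' (dist b x - t)) z,
      le_max_right (dist b z - t) (dist x z - (dist b x - t))]

end Geometry

/-! ### Clusters of balls in a hyperbolic space -/

section Clusters

variable {X : Type w} [MetricSpace X] {δ : ℝ} {E ι : Type*}

/-- A family of sets in a metric space, each contained in a ball. The radius of the ball depends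
only on the type of the set. -/
structure BallFamily (X : Type w) [MetricSpace X] (E ι : Type*) where
  /-- the sets -/
  carrier : E → Set X
  /-- the centers -/
  center : E → X
  /-- the type of a set -/
  type : E → ι
  /-- the radius of the sets of a given type -/
  radius : ι → ℝ
  dist_le : ∀ F, ∀ z ∈ carrier F, dist (center F) z ≤ radius (type F)

namespace BallFamily

variable (B : BallFamily X E ι) (b : X) (ℓ : ℝ)

/-- The largest distance from `b` that points of the ball around a set can have. -/
noncomputable def reach (F : E) : ℝ := dist b (B.center F) + B.radius (B.type F)

/-- If a set contains a point at distance more than `ℓ` from `b`, then the geodesics from `b`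
to this point and to the center of the set stay close up to this time. -/
noncomputable def level (F : E) : ℝ := (dist b (B.center F) - B.radius (B.type F) + ℓ) / 2

/-- Two sets share a point at distance more than `ℓ` from `b`. -/
def Meets (F F' : E) : Prop := ∃ z ∈ B.carrier F, z ∈ B.carrier F' ∧ ℓ < dist b z

/-- Two sets are linked by a chain of sets in `W`, each of which meets the next one. -/
def Linked (W : Set E) : E → E → Prop :=
  Relation.ReflTransGen fun F F' => F ∈ W ∧ F' ∈ W ∧ B.Meets b ℓ F F'

variable {B b ℓ}

lemma Meets.symm {F F' : E} (h : B.Meets b ℓ F F') : B.Meets b ℓ F' F := by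
  obtain ⟨z, h1, h2, h3⟩ := h
  exact ⟨z, h2, h1, h3⟩

lemma Linked.symm {W : Set E} {F F' : E} (h : B.Linked b ℓ W F F') : B.Linked b ℓ W F' F := by
  induction h with
  | refl => exact Relation.ReflTransGen.refl
  | tail _ h ih => exact Relation.ReflTransGen.head ⟨h.2.1, h.1, h.2.2.symm⟩ ih

lemma Linked.trans {W : Set E} {F F' F'' : E} (h : B.Linked b ℓ W F F')
    (h' : B.Linked b ℓ W F' F'') : B.Linked b ℓ W F F'' :=
  Relation.ReflTransGen.trans h h'

lemma Linked.mono {W W' : Set E} (hW : W ⊆ W') {F F' : E} (h : B.Linked b ℓ W F F') :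
    B.Linked b ℓ W' F F' :=
  Relation.ReflTransGen.mono (fun _ _ h => ⟨hW h.1, hW h.2.1, h.2.2⟩) _ _ h

lemma Linked.mem {W : Set E} {F F' : E} (h : B.Linked b ℓ W F F') (hF : F ∈ W) : F' ∈ W := by
  induction h with
  | refl => exact hF
  | tail _ h _ => exact h.2.1

lemma dist_le_reach {F : E} {z : X} (hz : z ∈ B.carrier F) : dist b z ≤ B.reach b F :=
  (dist_triangle b (B.center F) z).trans (add_le_add_right (B.dist_le F z hz) _)

lemma Meets.lt_reach {F F' : E} (h : B.Meets b ℓ F F') : ℓ < B.reach b F := by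
  obtain ⟨z, h1, -, h3⟩ := h
  exact h3.trans_le (dist_le_reach h1)

lemma level_le_dist {F : E} (h : ℓ ≤ B.reach b F) : B.level b ℓ F ≤ dist b (B.center F) := by
  unfold reach at h; unfold level; linarith

lemma level_le_gromovProduct {F : E} {z : X} (hz : z ∈ B.carrier F) (hb : ℓ ≤ dist b z) :
    B.level b ℓ F ≤ gromovProduct (B.center F) z b := by
  have := B.dist_le F z hz
  unfold level gromovProduct
  linarith [dist_comm b (B.center F), dist_comm b z]

/-- Both centers are seen in the direction of the shared point, and passing through it costs one
four point condition. -/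
lemma Meets.le_gromovProduct (h : IsHyperbolic δ X) {F F' : E} (hm : B.Meets b ℓ F F') {s : ℝ}
    (hF : s ≤ B.level b ℓ F) (hF' : s ≤ B.level b ℓ F') :
    s - δ ≤ gromovProduct (B.center F) (B.center F') b := by
  obtain ⟨z, h1, h2, h3⟩ := hm
  refine h.le_gromovProduct_trans (hF.trans (level_le_gromovProduct h1 h3.le)) ?_
  rw [gromovProduct_comm]
  exact hF'.trans (level_le_gromovProduct h2 h3.le)

/-- Two sets of the same type whose centers are seen from `b` in the same direction up to the
level of one of them have close centers. -/
lemma dist_center_le {F F' : E} (ht : B.type F = B.type F') {D κ : ℝ}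
    (hD : B.reach b F' ≤ D)
    (hp : B.level b ℓ F - κ ≤ gromovProduct (B.center F) (B.center F') b) :
    dist (B.center F) (B.center F') ≤ D - ℓ + 2 * κ := by
  unfold level gromovProduct at hp
  unfold reach at hD
  rw [← ht] at hD
  linarith [dist_comm b (B.center F), dist_comm b (B.center F')]

/-- Linked sets are seen from `b` in the same direction, with an error that depends only on the
number of types. -/
lemma Linked.le_gromovProduct [Finite E] [Finite ι] (h : IsHyperbolic δ X) (hδ : 0 ≤ δ)
    {D : ℝ} {n : ℕ}
    (hD : ∀ F, B.reach b F ≤ D)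
    (hsep : ∀ F F', B.type F = B.type F' →
      dist (B.center F) (B.center F') ≤ D - ℓ + 2 * ((2 * n + 1) * δ) → F = F')
    (m : ℕ) (hmn : m ≤ n) (W : Set E) (hW : (B.type '' W).ncard ≤ m)
    (hreach : ∀ F ∈ W, ℓ ≤ B.reach b F) {F F' : E} (hF : F ∈ W) {s : ℝ}
    (hs : ∀ F'', B.Linked b ℓ W F F'' → s ≤ B.level b ℓ F'')
    (hl : B.Linked b ℓ W F F') :
    s - (2 * m + 1) * δ ≤ gromovProduct (B.center F) (B.center F') b := by
  induction m generalizing W F F' s with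
  | zero =>
    have : B.type '' W = ∅ := by
      rw [← Set.ncard_eq_zero (Set.toFinite _)]; omega
    rw [Set.image_eq_empty] at this
    simp [this] at hF
  | succ m ih =>
    -- The set of minimal level serves as a hub: its level bounds all others in the class from
    -- below, and `F` and `F'` are compared through it at the cost of one more `δ`.
    obtain ⟨F₀, hF₀, hmin⟩ := Set.exists_min_image {F'' | B.Linked b ℓ W F F''} (B.level b ℓ)
      (Set.toFinite _) ⟨F, Relation.ReflTransGen.refl⟩
    have hF₀W : F₀ ∈ W := Linked.mem hF₀ hF
    set s₀ := B.level b ℓ F₀ with hs₀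
    have hmδ : 0 ≤ m * δ := by positivity
    have hmnδ : (m + 1) * δ ≤ n * δ :=
      mul_le_mul_of_nonneg_right (by exact_mod_cast hmn) hδ
    set W₁ : Set E := {F'' ∈ W | B.type F'' ≠ B.type F₀} with hW₁
    have hsub : W₁ ⊆ W := Set.sep_subset _ _
    have hcard : (B.type '' W₁).ncard ≤ m := by
      have : B.type '' W₁ ⊂ B.type '' W := by
        refine ⟨Set.image_mono hsub, fun hh => ?_⟩
        obtain ⟨F₁, h1, h2⟩ := hh ⟨F₀, hF₀W, rfl⟩
        exact h1.2 h2
      have := Set.ncard_lt_ncard this (Set.toFinite _)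
      omega
    have hmin' : ∀ {F''}, B.Linked b ℓ W F₀ F'' → s₀ ≤ B.level b ℓ F'' :=
      fun {F''} hh => hmin F'' (hF₀.trans hh)
    have hIH : ∀ {F₁ F₂}, F₁ ∈ W₁ → B.Meets b ℓ F₀ F₁ → B.Linked b ℓ W₁ F₁ F₂ →
        s₀ - (2 * m + 2) * δ ≤ gromovProduct (B.center F₀) (B.center F₂) b := by
      intro F₁ F₂ h1 hm h12
      have hl1 : B.Linked b ℓ W F₀ F₁ := Relation.ReflTransGen.single ⟨hF₀W, hsub h1, hm⟩
      have e1 : s₀ - (2 * m + 1) * δ ≤ gromovProduct (B.center F₀) (B.center F₁) b := by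
        have := Meets.le_gromovProduct h hm le_rfl (hmin' hl1)
        linarith
      have e2 := ih (by omega) W₁ hcard (fun F hF => hreach F (hsub hF)) h1
        (fun F'' hh => hmin' (hl1.trans (hh.mono hsub))) h12
      have := h.le_gromovProduct_trans e1 e2
      linarith
    -- If a chain from `F₀` returns to the type of `F₀`, the accumulated error is at most `(2 * m +
    -- 3) * δ ≤ (2 * n + 1) * δ`, so `hsep` forces it to be at `F₀` itself. The chain can be
    -- restarted there, and what follows avoids this type, so induction applies.
    have near : ∀ F'', B.Linked b ℓ W F₀ F'' → F₀ = F'' ∨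
        ∃ F₁ ∈ W₁, B.Meets b ℓ F₀ F₁ ∧ B.Linked b ℓ W₁ F₁ F'' := by
      intro F'' hh
      induction hh with
      | refl => exact Or.inl rfl
      | @tail F₂ F₃ h2 h3 hnear =>
        obtain ⟨m2, m3, h23⟩ := h3
        have hl3 : B.Linked b ℓ W F₀ F₃ := Relation.ReflTransGen.tail h2 ⟨m2, m3, h23⟩
        have e23 := Meets.le_gromovProduct h h23 (hmin' h2) (hmin' hl3)
        by_cases ht : B.type F₃ = B.type F₀
        · left
          refine hsep _ _ ht.symm (dist_center_le ht.symm (hD _) ?_)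
          rcases hnear with rfl | ⟨F₁, h1, hm, h12⟩
          · linarith
          · have e2 := hIH h1 hm h12
            have := h.le_gromovProduct_trans e2 (by linarith : _ ≤ _)
            linarith
        · right
          rcases hnear with rfl | ⟨F₁, h1, hm, h12⟩
          · exact ⟨F₃, ⟨m3, ht⟩, h23, Relation.ReflTransGen.refl⟩
          · exact ⟨F₁, h1, hm, Relation.ReflTransGen.tail h12 ⟨h12.mem h1, ⟨m3, ht⟩, h23⟩⟩
    have key : ∀ {F''}, B.Linked b ℓ W F₀ F'' →
        s₀ - (2 * m + 2) * δ ≤ gromovProduct (B.center F₀) (B.center F'') b := by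
      intro F'' hh
      rcases near F'' hh with rfl | ⟨F₁, h1, hm, h12⟩
      · rw [gromovProduct_self]
        have := level_le_dist (hreach _ hF₀W)
        linarith
      · exact hIH h1 hm h12
    have e1 := key hF₀.symm
    rw [gromovProduct_comm] at e1
    have e2 := h.le_gromovProduct_trans e1 (key (hF₀.symm.trans hl))
    have := hs F₀ hF₀
    push_cast
    linarith

/-- Among finitely many sets of at most `n` types, sets of the same type being far from each
other, there is a cluster `C` which is separated from the other sets far away from `b`, and such
that the part of `C` which is not far from `b` lies in a ball smaller than that of one of the
sets in `C`, the only one of its type. -/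
theorem exists_cluster [Finite E] [Nonempty E] [Fintype ι] (B : BallFamily X E ι)
    (h : IsHyperbolic δ X) (hδ : 0 < δ) {n : ℕ} (hn : Fintype.card ι ≤ n)
    (hsep : ∀ F F', B.type F = B.type F' →
      dist (B.center F) (B.center F') ≤ (4 * n ^ 2 + 16 * n + 10) * δ → F = F') (b : X) :
    ∃ (C : Set E) (F₀ : E) (p : X) (ℓ : ℝ), F₀ ∈ C ∧
      (∀ F ∈ C, B.type F = B.type F₀ → F = F₀) ∧
      (∀ F ∈ C, ∀ F', B.Meets b ℓ F F' → F' ∈ C) ∧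
      (∀ F ∈ C, ∀ z ∈ B.carrier F, dist b z ≤ ℓ → dist p z < B.radius (B.type F₀) - δ) := by
  obtain ⟨Fm, hD⟩ := Finite.exists_max (B.reach b)
  set D := B.reach b Fm with hDdef
  -- Half of `v` pays for the error of direction `(2 * n + 1) * δ`, two uses of thinness, and the
  -- desired gain of one `δ`.
  set v : ℝ := 2 * (2 * n + 4) * δ with hv
  have hv0 : 0 < v := by positivity
  -- There is one more threshold than there can be types, for the pigeonhole argument below.
  let lev : Fin (n + 1) → ℝ := fun k => D - (k + 1) * v
  let W : Fin (n + 1) → Set E := fun k => {F | lev k < B.reach b F}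
  let C : Fin (n + 1) → Set E := fun k => {F | B.Linked b (lev k) (W k) Fm F}
  have hlev : ∀ k, lev k < D := fun k => by
    have : 0 < ((k : ℝ) + 1) * v := by positivity
    simp only [lev]; linarith
  have hmin : ∀ k, ∃ F₀ ∈ C k, ∀ F ∈ C k, B.level b (lev k) F₀ ≤ B.level b (lev k) F := fun k =>
    Set.exists_min_image (C k) _ (Set.toFinite _) ⟨Fm, Relation.ReflTransGen.refl⟩
  choose F₀ hF₀ hmin using hmin
  have hW : ∀ k, ∀ F ∈ C k, F ∈ W k := fun k F hF => Linked.mem hF (hlev k)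
  -- For the lowest threshold, `(n + 1) * v + 2 * (2 * n + 1) * δ` is exactly the right side; this
  -- is the origin of the separation constant.
  have hbound : ∀ k, D - lev k + 2 * ((2 * n + 1) * δ) ≤ (4 * n ^ 2 + 16 * n + 10) * δ := by
    intro k
    have hk : ((k : ℕ) : ℝ) ≤ n := by exact_mod_cast Nat.lt_succ_iff.1 k.2
    have := mul_le_mul_of_nonneg_right hk hv0.le
    simp only [lev, hv] at *
    nlinarith
  have hprod : ∀ k, ∀ F ∈ C k, B.level b (lev k) (F₀ k) - (2 * n + 1) * δ ≤
      gromovProduct (B.center (F₀ k)) (B.center F) b := by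
    intro k F hF
    refine Linked.le_gromovProduct h hδ.le hD
      (fun F F' ht hd => hsep F F' ht (hd.trans (hbound k))) n le_rfl (W k) ?_
      (fun F hF => hF.le) (hW k _ (hF₀ k)) (fun F hF => hmin k F ((hF₀ k).trans hF))
      ((hF₀ k).symm.trans hF)
    refine (Set.ncard_le_card _).trans ?_
    rwa [Nat.card_eq_fintype_card]
  have huniq : ∀ k, ∀ F ∈ C k, B.type F = B.type (F₀ k) → F = F₀ k := fun k F hF ht =>
    (hsep _ _ ht.symm ((dist_center_le ht.symm (hD F) (hprod k F hF)).trans (hbound k))).symm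
  have hmono : ∀ k l, k ≤ l → C k ⊆ C l := by
    intro k l hkl F hF
    have : lev l ≤ lev k := by
      have : ((k : ℕ) : ℝ) ≤ l := by exact_mod_cast hkl
      have := mul_le_mul_of_nonneg_right this hv0.le
      simp only [lev]; linarith
    exact Relation.ReflTransGen.mono (fun _ _ hh => ⟨this.trans_lt hh.1, this.trans_lt hh.2.1,
      hh.2.2.imp fun z hz => ⟨hz.1, hz.2.1, this.trans_lt hz.2.2⟩⟩) _ _ hF
  -- Two thresholds have minimal sets of the same type. Clusters grow as the threshold drops, so
  -- uniqueness in the larger cluster identifies these sets; the common set then reaches beyond the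
  -- higher threshold, at least `v` above the lower one.
  obtain ⟨l, hl⟩ : ∃ l, lev l + v < B.reach b (F₀ l) := by
    obtain ⟨k, l, hkl, heq⟩ := Fintype.exists_ne_map_eq_of_card_lt (fun k => B.type (F₀ k))
      (by rw [Fintype.card_fin]; omega)
    wlog hlt : k < l generalizing k l
    · exact this l k hkl.symm heq.symm (lt_of_le_of_ne (not_lt.1 hlt) hkl.symm)
    refine ⟨l, ?_⟩
    rw [← huniq l _ (hmono k l hlt.le (hF₀ k)) heq]
    refine lt_of_le_of_lt ?_ (hW k _ (hF₀ k))
    have : ((k : ℕ) : ℝ) + 1 ≤ l := by exact_mod_cast hlt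
    have := mul_le_mul_of_nonneg_right this hv0.le
    simp only [lev]; linarith
  obtain ⟨γ, hγ⟩ := h.1 b (B.center (F₀ l))
  -- Up to this time the geodesics to all centers in the cluster stay close to `γ`. If the second
  -- term is negative, the base point itself serves as the new center.
  set s := max 0 (B.level b (lev l) (F₀ l) - (2 * n + 1) * δ) with hs
  refine ⟨C l, F₀ l, γ s, lev l, hF₀ l, huniq l, ?_, ?_⟩
  · intro F hF F' hm
    exact Relation.ReflTransGen.tail hF ⟨hW l F hF, hm.symm.lt_reach, hm⟩
  · intro F hF z hz hzl
    suffices hh : dist (γ s) z ≤ lev l - s + 2 * δ by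
      have h1 : B.level b (lev l) (F₀ l) - (2 * n + 1) * δ ≤ s := le_max_right _ _
      unfold level at h1
      unfold reach at hl
      simp only [hv] at hl
      linarith
    rcases le_total (B.level b (lev l) (F₀ l) - (2 * n + 1) * δ) 0 with hc | hc
    · rw [hs, max_eq_left hc, hγ.1]
      linarith
    · rw [max_eq_right hc] at hs
      obtain ⟨γ', hγ'⟩ := h.1 b (B.center F)
      have hsp : s ≤ gromovProduct (B.center (F₀ l)) (B.center F) b := hs ▸ hprod l F hF
      have h0 : 0 ≤ s := hs ▸ hc
      have h1 := h.2 b _ _ γ γ' hγ hγ' s h0 hsp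
      have h2 := h.dist_geodesic_le hγ' h0 (hsp.trans (gromovProduct_le_right _ _ _)) z
      -- The second entry is bounded because `s` does not exceed the level of `F`, which was defined
      -- as half a sum for this purpose.
      have h3 : max (dist b z - s) (dist (B.center F) z - (dist b (B.center F) - s)) ≤
          lev l - s := by
        refine max_le (by linarith) ?_
        have h4 := B.dist_le F z hz
        have h5 := hmin l F hF
        have h6 : 0 ≤ (2 * n + 1) * δ := by positivity
        have h7 : s ≤ B.level b (lev l) F := by linarith
        unfold level at h7
        linarith
      linarith [dist_triangle (γ s) (γ' s) z]

end BallFamily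

end Clusters

/-! ### Elimination over a group algebra -/

section Elimination

open MonoidAlgebra

variable {k : Type*} {G : Type*} [Group G] {α ι : Type*}

lemma exists_of_coeff_smul_ne_zero [CommRing k] {ν : MonoidAlgebra k G}
    {v : α →₀ MonoidAlgebra k G} {x : α} {g : G} (h : ((ν • v) x).coeff g ≠ 0) :
    ∃ s, ν.coeff s ≠ 0 ∧ (v x).coeff (s⁻¹ * g) ≠ 0 := by
  rw [Finsupp.smul_apply, smul_eq_mul, coeff_mul_apply_left] at h
  obtain ⟨s, hs, hne⟩ := Finset.exists_ne_zero_of_sum_ne_zero h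
  exact ⟨s, left_ne_zero_of_mul hne, right_ne_zero_of_mul hne⟩

lemma exists_of_coeff_sum_smul_ne_zero [CommRing k] [Fintype ι] {ν : ι → MonoidAlgebra k G}
    {v : ι → α →₀ MonoidAlgebra k G} {x : α} {g : G}
    (h : ((∑ i, ν i • v i) x).coeff g ≠ 0) :
    ∃ i s, (ν i).coeff s ≠ 0 ∧ (v i x).coeff (s⁻¹ * g) ≠ 0 := by
  rw [Finsupp.finsetSum_apply, coeff_sum, Finsupp.finsetSum_apply] at h
  obtain ⟨i, -, hi⟩ := Finset.exists_ne_zero_of_sum_ne_zero h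
  exact ⟨i, exists_of_coeff_smul_ne_zero hi⟩

variable {X : Type w} [MetricSpace X] [MulAction G X] [IsIsometricSMul G X] {δ : ℝ}

/-- If elements of a free module over the group algebra are linearly dependent, then one of them
can be replaced by a combination of them that has a smaller support. -/
theorem exists_shrinking_combination [CommRing k] [Fintype ι]
    (h : IsHyperbolic δ X) (hδ : 0 < δ) {n : ℕ} (hn : Fintype.card ι ≤ n)
    (hG : ∀ g : G, g ≠ 1 → ∀ p : X, (4 * n ^ 2 + 16 * n + 10) * δ < dist (g • p) p) (x₀ : X)
    (a : ι → α →₀ MonoidAlgebra k G) (c : ι → X) (r : ι → ℝ)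
    (ha : ∀ i x g, (a i x).coeff g ≠ 0 → dist (c i) (g • x₀) ≤ r i)
    (μ : ι → MonoidAlgebra k G) (hμ : ∑ i, μ i • a i = 0) (hμ0 : μ ≠ 0) :
    ∃ (j : ι) (ν : ι → MonoidAlgebra k G) (t : k) (p : X), μ j ≠ 0 ∧ t ≠ 0 ∧
      ν j = single 1 t ∧
      ∀ x g, ((∑ i, ν i • a i) x).coeff g ≠ 0 → dist p (g • x₀) < r j - δ := by
  classical
  let E := {e : ι × G // (μ e.1).coeff e.2 ≠ 0}
  have hfin : Finite E := by
    refine Finite.of_injective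
      (fun e : E => (⟨e.1.1, e.1.2, Finsupp.mem_support_iff.2 e.2⟩ :
        Σ i, {g // g ∈ (μ i).coeff.support})) ?_
    rintro ⟨⟨i, g⟩, hg⟩ ⟨⟨i', g'⟩, hg'⟩ heq
    simp only [Sigma.mk.injEq] at heq
    obtain ⟨rfl, heq⟩ := heq
    simp only [heq_eq_eq, Subtype.mk.injEq] at heq
    subst heq
    rfl
  have hne : Nonempty E := by
    obtain ⟨i, hi⟩ := Function.ne_iff.1 hμ0
    have : (μ i).coeff ≠ 0 := fun h0 => hi (coeff_eq_zero.1 h0)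
    obtain ⟨g, hg⟩ := Finsupp.ne_iff.1 this
    exact ⟨⟨(i, g), hg⟩⟩
  let B : BallFamily X E ι :=
    { carrier := fun e => {z | ∃ x g, (a e.1.1 x).coeff (e.1.2⁻¹ * g) ≠ 0 ∧ z = g • x₀}
      center := fun e => e.1.2 • c e.1.1
      type := fun e => e.1.1
      radius := r
      dist_le := by
        rintro ⟨⟨i, s⟩, hs⟩ z ⟨x, g, hg, rfl⟩
        have := ha i x _ hg
        rwa [← dist_smul s, smul_smul, mul_inv_cancel_left] at this }
  obtain ⟨C, ⟨⟨j, s₀⟩, hs₀⟩, p, ℓ, hmem, huniq, hclosed, hball⟩ :=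
    B.exists_cluster h hδ hn (by
      rintro ⟨⟨i, s⟩, hs⟩ ⟨⟨i', s'⟩, hs'⟩ rfl hd
      simp only [B] at hd
      by_contra hne
      have hne' : s'⁻¹ * s ≠ 1 := by
        intro h1
        have : s = s' := by rwa [inv_mul_eq_one, eq_comm] at h1
        subst this
        exact hne rfl
      have := hG _ hne' (c i)
      rw [← dist_smul s', smul_smul, mul_inv_cancel_left] at this
      exact absurd hd (not_le.2 this)) x₀
  -- The part of the relation `μ` carried by the cluster.
  let ν : ι → MonoidAlgebra k G := fun i =>
    ofCoeff ((μ i).coeff.filter fun g => ∃ hg : (μ i).coeff g ≠ 0, (⟨(i, g), hg⟩ : E) ∈ C)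
  have hν : ∀ i g (hg : (μ i).coeff g ≠ 0), (⟨(i, g), hg⟩ : E) ∈ C →
      (ν i).coeff g = (μ i).coeff g := fun i g hg hC =>
    Finsupp.filter_apply_pos _ _ ⟨hg, hC⟩
  have hν' : ∀ i g, (ν i).coeff g ≠ 0 → ∃ hg : (μ i).coeff g ≠ 0, (⟨(i, g), hg⟩ : E) ∈ C := by
    intro i g hg
    by_contra hcon
    exact hg (Finsupp.filter_apply_neg _ _ hcon)
  -- Any translate containing such a point meets `F` far away, hence lies in the cluster. So the
  -- rest of `μ` contributes nothing there, and the cluster part vanishes together with the full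
  -- sum.
  have hfar : ∀ F ∈ C, ∀ x g, g • x₀ ∈ B.carrier F → ℓ < dist x₀ (g • x₀) →
      ((∑ i, ν i • a i) x).coeff g = 0 := by
    intro F hF x g hg hl
    have hsub : ∑ i, (μ i - ν i) • a i = - ∑ i, ν i • a i := by
      simp only [sub_smul, Finset.sum_sub_distrib, hμ, zero_sub]
    by_contra hcon
    obtain ⟨i, s, h1, h2⟩ : ∃ i s, (μ i - ν i).coeff s ≠ 0 ∧ (a i x).coeff (s⁻¹ * g) ≠ 0 := by
      refine exists_of_coeff_sum_smul_ne_zero ?_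
      rw [hsub, Finsupp.neg_apply, coeff_neg, Finsupp.neg_apply]
      exact neg_ne_zero.2 hcon
    have hs : (μ i).coeff s ≠ 0 := by
      intro h0
      have : (ν i).coeff s = 0 := by
        by_contra h3
        exact (hν' i s h3).1 h0
      rw [coeff_sub, Finsupp.sub_apply, h0, this, sub_zero] at h1
      exact h1 rfl
    refine h1 ?_
    rw [coeff_sub, Finsupp.sub_apply,
      hν i s hs (hclosed F hF ⟨(i, s), hs⟩ ⟨g • x₀, hg, ⟨x, g, h2, rfl⟩, hl⟩), sub_self]
  -- Translating by `s₀⁻¹` turns the only term of `ν j` into a scalar.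
  refine ⟨j, fun i => single s₀⁻¹ 1 * ν i, (μ j).coeff s₀, s₀⁻¹ • p, ?_, hs₀, ?_, ?_⟩
  · intro h0
    simp [h0] at hs₀
  · have : ν j = single s₀ ((μ j).coeff s₀) := by
      ext g
      rw [coeff_single, Finsupp.single_apply]
      split_ifs with hg
      · subst hg
        exact hν j _ hs₀ hmem
      · by_contra hcon
        obtain ⟨hg', hC⟩ := hν' j g hcon
        exact hg (congrArg (fun e : E => e.1.2) (huniq _ hC rfl)).symm
    simp [this, single_mul_single]
  · intro x g hg
    have hsum : ∑ i, (single s₀⁻¹ (1 : k) * ν i) • a i = single s₀⁻¹ (1 : k) • ∑ i, ν i • a i := by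
      simp only [mul_smul, Finset.smul_sum]
    rw [hsum, Finsupp.smul_apply, smul_eq_mul, coeff_single_mul_apply, one_mul, inv_inv] at hg
    obtain ⟨i, s, h1, h2⟩ := exists_of_coeff_sum_smul_ne_zero hg
    obtain ⟨hs, hC⟩ := hν' i s h1
    have hz : (s₀ * g) • x₀ ∈ B.carrier ⟨(i, s), hs⟩ := ⟨x, _, h2, rfl⟩
    have := hball _ hC _ hz (not_lt.1 fun hl => hg (hfar _ hC x _ hz hl))
    rwa [← dist_smul s₀, smul_smul, smul_smul, mul_inv_cancel, one_smul]

/-- The elimination algorithm: by repeatedly replacing an element by a combination, in which its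
coefficient is a scalar from `S`, one can make the nonzero elements linearly independent. -/
theorem exists_linearIndependent_ne_zero [CommRing k] [IsDomain k] [Fintype ι] [DecidableEq ι]
    (h : IsHyperbolic δ X) (hδ : 0 < δ) {n : ℕ} (hn : Fintype.card ι ≤ n)
    (hG : ∀ g : G, g ≠ 1 → ∀ p : X, (4 * n ^ 2 + 16 * n + 10) * δ < dist (g • p) p) [Nonempty X]
    (S : Set k) (hS : ∀ t : k, t ≠ 0 → ∃ s, s ≠ 0 ∧ s * t ∈ S)
    (P : (ι → α →₀ MonoidAlgebra k G) → Prop)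
    (hP : ∀ a j (ν : ι → MonoidAlgebra k G), P a → (∃ t ∈ S, ν j = single 1 t) →
      P (Function.update a j (∑ i, ν i • a i)))
    (a : ι → α →₀ MonoidAlgebra k G) (ha : P a) :
    ∃ a', P a' ∧ LinearIndependent (MonoidAlgebra k G) fun i : {i // a' i ≠ 0} => a' i := by
  classical
  obtain ⟨x₀⟩ := ‹Nonempty X›
  -- Radii are counted in units of `δ`, and their sum is the induction measure. The strict
  -- inequality makes `m i = 0` force `a i = 0`.
  suffices main : ∀ N : ℕ, ∀ (a : ι → α →₀ MonoidAlgebra k G) (c : ι → X) (m : ι → ℕ),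
      ∑ i, m i ≤ N → P a → (∀ i x g, (a i x).coeff g ≠ 0 → dist (c i) (g • x₀) < δ * m i) →
      ∃ a', P a' ∧ LinearIndependent (MonoidAlgebra k G) fun i : {i // a' i ≠ 0} => a' i by
    have : ∀ i, ∃ m : ℕ, ∀ x g, (a i x).coeff g ≠ 0 → dist x₀ (g • x₀) < δ * m := by
      intro i
      let T : Finset ℕ := (a i).support.biUnion fun x =>
        (a i x).coeff.support.image fun g => ⌊dist x₀ (g • x₀) / δ⌋₊ + 1
      refine ⟨T.sup id, fun x g hg => ?_⟩
      have hx : a i x ≠ 0 := by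
        intro h0
        simp [h0] at hg
      have hT : ⌊dist x₀ (g • x₀) / δ⌋₊ + 1 ∈ T :=
        Finset.mem_biUnion.2 ⟨x, Finsupp.mem_support_iff.2 hx,
          Finset.mem_image.2 ⟨g, Finsupp.mem_support_iff.2 hg, rfl⟩⟩
      have h1 : ((⌊dist x₀ (g • x₀) / δ⌋₊ + 1 : ℕ) : ℝ) ≤ (T.sup id : ℕ) := by
        exact_mod_cast Finset.le_sup (f := id) hT
      have h2 := Nat.lt_floor_add_one (dist x₀ (g • x₀) / δ)
      push_cast at h1
      rw [mul_comm]
      exact (div_lt_iff₀ hδ).1 (h2.trans_le h1)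
    choose m hm using this
    exact main _ a (fun _ => x₀) m le_rfl ha hm
  intro N
  induction N with
  | zero =>
    intro a c m hN ha hm
    have hzero : ∀ i, a i = 0 := by
      intro i
      have hmi : m i = 0 := by
        have := Finset.single_le_sum (fun i _ => Nat.zero_le (m i)) (Finset.mem_univ i)
        omega
      ext x g
      by_contra hcon
      have := hm i x g hcon
      rw [hmi, Nat.cast_zero, mul_zero] at this
      exact absurd this (not_lt.2 dist_nonneg)
    have : IsEmpty {i // a i ≠ 0} := ⟨fun i => i.2 (hzero i)⟩
    exact ⟨a, ha, linearIndependent_empty_type⟩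
  | succ N ih =>
    intro a c m hN ha hm
    by_cases hli : LinearIndependent (MonoidAlgebra k G) fun i : {i // a i ≠ 0} => a i
    · exact ⟨a, ha, hli⟩
    obtain ⟨μ', hμ', i₀, hi₀⟩ := Fintype.not_linearIndependent_iff.1 hli
    -- Extending by zero ensures that the index `j` found below has `a j ≠ 0`, so that `m j` can be
    -- lowered.
    let μ : ι → MonoidAlgebra k G := fun i => if hi : a i ≠ 0 then μ' ⟨i, hi⟩ else 0
    have hμ : ∑ i, μ i • a i = 0 := by
      rw [← Fintype.sum_subtype_add_sum_subtype (fun i => a i ≠ 0)]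
      rw [Fintype.sum_eq_zero (fun i : {i // ¬ a i ≠ 0} => μ i • a i)
        (fun i => by rw [not_not.1 i.2, smul_zero]), add_zero]
      exact (Fintype.sum_congr (fun i : {i // a i ≠ 0} => μ i • a i) (fun i => μ' i • a i)
        fun i => by simp only [μ, dif_pos i.2]).trans hμ'
    have hμ0 : μ ≠ 0 := by
      intro h0
      have := congrFun h0 i₀
      simp only [μ, dif_pos i₀.2, Pi.zero_apply] at this
      exact hi₀ this
    obtain ⟨j, ν, t, p, hj, ht, hνj, hp⟩ := exists_shrinking_combination h hδ hn hG x₀ a c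
      (fun i => δ * m i) (fun i x g hg => (hm i x g hg).le) μ hμ hμ0
    obtain ⟨s, hs, hst⟩ := hS t ht
    have haj : a j ≠ 0 := by
      intro h0
      exact hj (by simp only [μ]; rw [dif_neg (not_not.2 h0)])
    have hmj : 1 ≤ m j := by
      by_contra hcon
      have hmj : m j = 0 := by omega
      refine haj ?_
      ext x g
      by_contra hcon
      have := hm j x g hcon
      rw [hmj, Nat.cast_zero, mul_zero] at this
      exact absurd this (not_lt.2 dist_nonneg)
    have hsum : ∑ i, (single 1 s * ν i) • a i = single (1 : G) s • ∑ i, ν i • a i := by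
      simp only [mul_smul, Finset.smul_sum]
    refine ih (Function.update a j (∑ i, (single 1 s * ν i) • a i)) (Function.update c j p)
      (Function.update m j (m j - 1)) ?_
      (hP a j _ ha ⟨s * t, hst, by rw [hνj, single_mul_single, one_mul]⟩) ?_
    · rw [Finset.sum_update_of_mem (Finset.mem_univ j)]
      rw [← Finset.add_sum_erase _ _ (Finset.mem_univ j), ← Finset.sdiff_singleton_eq_erase] at hN
      omega
    · intro i x g hg
      rcases eq_or_ne i j with rfl | hij
      · rw [Function.update_self] at hg ⊢
        rw [Function.update_self]
        rw [hsum, Finsupp.smul_apply, smul_eq_mul, coeff_single_mul_apply, inv_one, one_mul] at hg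
        have := hp x g (right_ne_zero_of_mul hg)
        rw [Nat.cast_sub hmj, Nat.cast_one, mul_sub, mul_one]
        exact this
      · rw [Function.update_of_ne hij] at hg ⊢
        rw [Function.update_of_ne hij]
        exact hm i x g hg

end Elimination

/-! ### Effect of a replacement on spans and independence -/

section Moves

/-- The multiplier is an integer because it has to commute with the coefficients of `v`. -/
lemma zsmul_mem_span_of_forall {R V ι : Type*} [Ring R] [AddCommGroup V] [Module R V] {a b : ι → V} {t : ℤ}
    (h : ∀ i, t • a i ∈ Submodule.span R (Set.range b)) {v : V}
    (hv : v ∈ Submodule.span R (Set.range a)) : t • v ∈ Submodule.span R (Set.range b) := by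
  induction hv using Submodule.span_induction with
  | mem x hx => obtain ⟨i, rfl⟩ := hx; exact h i
  | zero => rw [smul_zero]; exact Submodule.zero_mem _
  | add x y _ _ hx hy => rw [smul_add]; exact Submodule.add_mem _ hx hy
  | smul r x _ hx => rw [smul_comm]; exact Submodule.smul_mem _ _ hx

variable {R V ι : Type*} [Ring R] [AddCommGroup V] [Module R V] [Fintype ι] [DecidableEq ι]

lemma sum_smul_eq_add_sum_erase (a : ι → V) (ν : ι → R) (j : ι) :
    ν j • a j = ∑ i, ν i • a i - ∑ i ∈ Finset.univ.erase j, ν i • a i := by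
  rw [← Finset.add_sum_erase _ _ (Finset.mem_univ j), add_sub_cancel_right]

/-- Solving the new element for its `j`-th term bounds what a replacement loses: only a factor `ν j`
on `a j`. -/
lemma smul_mem_span_range_update (a : ι → V) (ν : ι → R) (j : ι) :
    ν j • a j ∈ Submodule.span R (Set.range (Function.update a j (∑ i, ν i • a i))) := by
  rw [sum_smul_eq_add_sum_erase]
  refine Submodule.sub_mem _ (Submodule.subset_span ⟨j, Function.update_self ..⟩)
    (Submodule.sum_mem _ fun i hi => Submodule.smul_mem _ _ (Submodule.subset_span ⟨i, ?_⟩))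
  rw [Function.update_of_ne (Finset.ne_of_mem_erase hi)]

/-- With coefficient one the replacement is a transvection; a relation among the new elements is
rewritten as one among the old. -/
lemma linearIndependent_update_sum {a : ι → V} (ha : LinearIndependent R a) (ν : ι → R) {j : ι}
    (hj : ν j = 1) : LinearIndependent R (Function.update a j (∑ i, ν i • a i)) := by
  rw [Fintype.linearIndependent_iff] at ha ⊢
  intro c hc
  have h1 : ∑ i, (if i = j then c j else c i + c j * ν i) • a i = 0 := by
    rw [← hc, ← Finset.add_sum_erase _ _ (Finset.mem_univ j),
      ← Finset.add_sum_erase _ (fun i => c i • Function.update a j _ i) (Finset.mem_univ j),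
      Function.update_self, ← Finset.add_sum_erase _ (fun i => ν i • a i) (Finset.mem_univ j), hj,
      smul_add, Finset.smul_sum, one_smul, if_pos rfl, add_assoc, ← Finset.sum_add_distrib]
    congr 1
    refine Finset.sum_congr rfl fun i hi => ?_
    rw [if_neg (Finset.ne_of_mem_erase hi), Function.update_of_ne (Finset.ne_of_mem_erase hi),
      add_smul, mul_smul, add_comm]
  have h2 := ha _ h1
  have h3 : c j = 0 := by simpa using h2 j
  intro i
  rcases eq_or_ne i j with rfl | hij
  · exact h3
  · simpa [hij, h3] using h2 i

end Moves

/-! ### Freeness of pure submodules over the integral group ring -/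

section Integral

open MonoidAlgebra

variable {G : Type*} [Group G] {α : Type*}

/-- Reduction of coefficients modulo `p` on a free module over the integral group ring. -/
noncomputable def reduceMod (p : ℕ) (G : Type*) [Group G] (α : Type*) :
    (α →₀ MonoidAlgebra ℤ G) →ₛₗ[mapRingHom G (Int.castRingHom (ZMod p))]
      (α →₀ MonoidAlgebra (ZMod p) G) where
  toFun := Finsupp.mapRange (mapRingHom G (Int.castRingHom (ZMod p))) (map_zero _)
  map_add' := Finsupp.mapRange_add (map_add _)
  map_smul' c v := by ext1 x; simp

lemma reduceMod_apply (p : ℕ) (v : α →₀ MonoidAlgebra ℤ G) (x : α) :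
    reduceMod p G α v x = mapRingHom G (Int.castRingHom (ZMod p)) (v x) := rfl

lemma exists_eq_zsmul_of_mapRingHom_eq_zero {p : ℕ} {x : MonoidAlgebra ℤ G}
    (h : mapRingHom G (Int.castRingHom (ZMod p)) x = 0) : ∃ y, x = (p : ℤ) • y := by
  refine ⟨ofCoeff (x.coeff.mapRange (· / (p : ℤ)) (Int.zero_ediv _)), ?_⟩
  ext g
  have : (mapRingHom G (Int.castRingHom (ZMod p)) x).coeff g = 0 := by rw [h]; rfl
  rw [coeff_mapRingHom] at this
  have hd := (ZMod.intCast_zmod_eq_zero_iff_dvd _ _).1 this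
  rw [coeff_smul_apply, coeff_ofCoeff, Finsupp.mapRange_apply, smul_eq_mul, Int.mul_ediv_cancel' hd]

lemma exists_eq_zsmul_of_reduceMod_eq_zero {p : ℕ} {v : α →₀ MonoidAlgebra ℤ G}
    (h : reduceMod p G α v = 0) : ∃ y, v = (p : ℤ) • y := by
  classical
  have : ∀ x, ∃ y, v x = (p : ℤ) • y := fun x =>
    exists_eq_zsmul_of_mapRingHom_eq_zero (by rw [← reduceMod_apply, h]; rfl)
  choose y hy using this
  refine ⟨Finsupp.onFinset v.support (fun x => if v x = 0 then 0 else y x) (fun x hx => ?_), ?_⟩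
  · rw [Finsupp.mem_support_iff]
    intro h0
    exact hx (if_pos h0)
  · ext1 x
    rw [Finsupp.smul_apply, Finsupp.onFinset_apply]
    split_ifs with h0
    · rw [h0, smul_zero]
    · exact hy x

lemma zsmul_cancel {t : ℤ} (ht : t ≠ 0) {x : MonoidAlgebra ℤ G} (h : t • x = 0) : x = 0 := by
  ext g
  have : (t • x).coeff g = 0 := by rw [h]; rfl
  rw [coeff_smul_apply, smul_eq_mul] at this
  exact (mul_eq_zero.1 this).resolve_left ht

lemma zsmul_cancel_finsupp {t : ℤ} (ht : t ≠ 0) {v : α →₀ MonoidAlgebra ℤ G} (h : t • v = 0) :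
    v = 0 := by
  ext1 x
  refine zsmul_cancel ht ?_
  rw [← Finsupp.smul_apply, h, Finsupp.zero_apply]

variable {X : Type w} [MetricSpace X] [MulAction G X] [IsIsometricSMul G X] [Nonempty X] {δ : ℝ}

/-- The inductive step for `free_of_pure`: a free submodule containing `p N • M` is enlarged to
one that contains `N • M`. -/
lemma exists_linearIndependent_of_prime_mul {κ : Type*} [Fintype κ]
    (h : IsHyperbolic δ X) (hδ : 0 < δ) {n : ℕ} (hn : Fintype.card κ ≤ n)
    (hG : ∀ g : G, g ≠ 1 → ∀ p : X, (4 * n ^ 2 + 16 * n + 10) * δ < dist (g • p) p)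
    (M : Submodule (MonoidAlgebra ℤ G) (α →₀ MonoidAlgebra ℤ G))
    (hpure : ∀ (t : ℤ) v, t ≠ 0 → t • v ∈ M → v ∈ M) {p : ℕ} (hp : p.Prime) (N : ℕ)
    (e : κ → α →₀ MonoidAlgebra ℤ G) (he : LinearIndependent (MonoidAlgebra ℤ G) e)
    (heM : ∀ i, e i ∈ M)
    (hN : ∀ v ∈ M, ((p * N : ℕ) : ℤ) • v ∈ Submodule.span (MonoidAlgebra ℤ G) (Set.range e)) :
    ∃ e' : κ → α →₀ MonoidAlgebra ℤ G, LinearIndependent (MonoidAlgebra ℤ G) e' ∧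
      (∀ i, e' i ∈ M) ∧
      ∀ v ∈ M, (N : ℤ) • v ∈ Submodule.span (MonoidAlgebra ℤ G) (Set.range e') := by
  classical
  have := Fact.mk hp
  have hp0 : (p : ℤ) ≠ 0 := by exact_mod_cast hp.ne_zero
  -- Elimination runs on the reductions while the invariant carries integral lifts along. Allowing
  -- only the scalar `1` makes each move liftable to a transvection.
  obtain ⟨ē, ⟨e, he, heM, hN, hē⟩, hli⟩ := exists_linearIndependent_ne_zero (k := ZMod p) h hδ hn
    hG {1} (fun t ht => ⟨t⁻¹, inv_ne_zero ht, inv_mul_cancel₀ ht⟩)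
    (fun ē : κ → α →₀ MonoidAlgebra (ZMod p) G => ∃ e : κ → α →₀ MonoidAlgebra ℤ G,
      LinearIndependent (MonoidAlgebra ℤ G) e ∧ (∀ i, e i ∈ M) ∧
      (∀ v ∈ M, ((p * N : ℕ) : ℤ) • v ∈ Submodule.span (MonoidAlgebra ℤ G) (Set.range e)) ∧
      ∀ i, reduceMod p G α (e i) = ē i)
    (by
      rintro ē j ν ⟨e, he, heM, hN, hē⟩ ⟨t, rfl, hνj⟩
      have hsurj : Function.Surjective (mapRingHom G (Int.castRingHom (ZMod p))) :=
        map_surjective _ ZMod.intCast_surjective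
      choose ν' hν' using fun i => hsurj (ν i)
      -- The lift at `j` must be `1` itself, not just congruent to `1` modulo `p`.
      set μ := Function.update ν' j 1 with hμdef
      have hμj : μ j = 1 := Function.update_self ..
      have hμ : ∀ i, mapRingHom G (Int.castRingHom (ZMod p)) (μ i) = ν i := by
        intro i
        rcases eq_or_ne i j with rfl | hij
        · rw [hμj, map_one, hνj, one_def]
        · rw [hμdef, Function.update_of_ne hij, hν']
      refine ⟨Function.update e j (∑ i, μ i • e i), linearIndependent_update_sum he μ hμj, ?_, ?_,
        ?_⟩
      · intro i
        rcases eq_or_ne i j with rfl | hij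
        · rw [Function.update_self]
          exact Submodule.sum_mem _ fun i _ => Submodule.smul_mem _ _ (heM i)
        · rw [Function.update_of_ne hij]
          exact heM i
      · intro v hv
        rw [← one_smul ℤ (_ • v)]
        refine zsmul_mem_span_of_forall (fun i => ?_) (hN v hv)
        rw [one_smul]
        rcases eq_or_ne i j with rfl | hij
        · have := smul_mem_span_range_update e μ i
          rwa [hμj, one_smul] at this
        · exact Submodule.subset_span ⟨i, Function.update_of_ne hij _ _⟩
      · intro i
        rcases eq_or_ne i j with rfl | hij
        · rw [Function.update_self, Function.update_self, map_sum]
          exact Finset.sum_congr rfl fun i _ => by rw [map_smulₛₗ, hμ, hē]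
        · rw [Function.update_of_ne hij, Function.update_of_ne hij, hē])
    (fun i => reduceMod p G α (e i)) ⟨e, he, heM, hN, fun _ => rfl⟩
  -- Elements that reduce to zero are divided by `p`; purity keeps the quotients in `M`.
  have hdiv : ∀ i, ∃ f, (ē i = 0 → e i = (p : ℤ) • f) ∧ (ē i ≠ 0 → e i = f) := by
    intro i
    by_cases h0 : ē i = 0
    · obtain ⟨f, hf⟩ := exists_eq_zsmul_of_reduceMod_eq_zero ((hē i).trans h0)
      exact ⟨f, fun _ => hf, fun h1 => absurd h0 h1⟩
    · exact ⟨e i, fun h1 => absurd h1 h0, fun _ => rfl⟩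
  choose f hf0 hf1 using hdiv
  refine ⟨f, ?_, ?_, ?_⟩
  · rw [Fintype.linearIndependent_iff] at he ⊢
    intro c hc i
    have h1 : ∑ i, (if ē i = 0 then c i else (p : ℤ) • c i) • e i = 0 := by
      refine Eq.trans ?_ (show (p : ℤ) • ∑ i, c i • f i = 0 by rw [hc, smul_zero])
      rw [Finset.smul_sum]
      refine Finset.sum_congr rfl fun i _ => ?_
      split_ifs with h0
      · rw [hf0 i h0, smul_comm]
      · rw [hf1 i h0, smul_assoc]
    have h2 := he _ h1 i
    split_ifs at h2 with h0
    · exact h2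
    · exact zsmul_cancel hp0 h2
  · intro i
    by_cases h0 : ē i = 0
    · exact hpure p _ hp0 (hf0 i h0 ▸ heM i)
    · exact hf1 i h0 ▸ heM i
  · intro v hv
    obtain ⟨c, hc⟩ := (Submodule.mem_span_range_iff_exists_fun _).1 (hN v hv)
    -- The left side of `hc` vanishes modulo `p`, so independence of the nonzero reductions makes
    -- their coefficients divisible by `p`. The undivided elements thus give up a factor `p` in the
    -- coefficient, the divided ones in the element.
    have hzero : ∑ i : {i // ē i ≠ 0}, mapRingHom G (Int.castRingHom (ZMod p)) (c i) • ē i = 0 := by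
      have h1 : ∑ i, mapRingHom G (Int.castRingHom (ZMod p)) (c i) • ē i = 0 := by
        have := congrArg (reduceMod p G α) hc
        rw [map_sum] at this
        simp only [map_smulₛₗ, hē] at this
        rw [this]
        ext x g
        rw [reduceMod_apply, coeff_mapRingHom, Finsupp.smul_apply, coeff_smul_apply]
        simp
      rw [← Fintype.sum_subtype_add_sum_subtype (fun i => ē i ≠ 0)] at h1
      rwa [Fintype.sum_eq_zero (fun i : {i // ¬ ē i ≠ 0} => _ • ē i)
        (fun i => by rw [not_not.1 i.2, smul_zero]), add_zero] at h1
    have hdvd : ∀ i, ∃ d, ē i ≠ 0 → c i = (p : ℤ) • d := by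
      intro i
      by_cases h0 : ē i = 0
      · exact ⟨0, fun h1 => absurd h0 h1⟩
      · obtain ⟨d, hd⟩ := exists_eq_zsmul_of_mapRingHom_eq_zero
          (Fintype.linearIndependent_iff.1 hli _ hzero ⟨i, h0⟩)
        exact ⟨d, fun _ => hd⟩
    choose d hd using hdvd
    have hv' : (N : ℤ) • v = ∑ i, (if ē i = 0 then c i else d i) • f i := by
      rw [← sub_eq_zero]
      refine zsmul_cancel_finsupp hp0 ?_
      rw [smul_sub, smul_smul, ← Nat.cast_mul, ← hc, sub_eq_zero, Finset.smul_sum]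
      refine Finset.sum_congr rfl fun i _ => ?_
      split_ifs with h0
      · rw [hf0 i h0, smul_comm]
      · rw [hd i h0, hf1 i h0, smul_assoc]
    rw [hv']
    exact Submodule.sum_mem _ fun i _ => Submodule.smul_mem _ _ (Submodule.subset_span ⟨i, rfl⟩)

/-- A submodule of a free module over the integral group ring that is generated by few elements
is free if the quotient has no additive torsion. -/
theorem free_of_pure (h : IsHyperbolic δ X) (hδ : 0 < δ) {n : ℕ}
    (hG : ∀ g : G, g ≠ 1 → ∀ p : X, (4 * n ^ 2 + 16 * n + 10) * δ < dist (g • p) p)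
    (M : Submodule (MonoidAlgebra ℤ G) (α →₀ MonoidAlgebra ℤ G))
    (hpure : ∀ (t : ℤ) v, t ≠ 0 → t • v ∈ M → v ∈ M)
    (a : Fin n → α →₀ MonoidAlgebra ℤ G)
    (ha : Submodule.span (MonoidAlgebra ℤ G) (Set.range a) = M) :
    Module.Free (MonoidAlgebra ℤ G) M := by
  classical
  -- Here every nonzero scalar is allowed, and a move with scalar `t` multiplies `N` by `t`.
  obtain ⟨e, ⟨heM, N, hN0, hN⟩, hli⟩ := exists_linearIndependent_ne_zero (k := ℤ) h hδ
    (Fintype.card_fin n).le hG {t | t ≠ 0} (fun t ht => ⟨1, one_ne_zero, by simpa using ht⟩)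
    (fun e : Fin n → α →₀ MonoidAlgebra ℤ G => (∀ i, e i ∈ M) ∧ ∃ N : ℤ, N ≠ 0 ∧
      ∀ v ∈ M, N • v ∈ Submodule.span (MonoidAlgebra ℤ G) (Set.range e))
    (by
      rintro e j ν ⟨heM, N, hN0, hN⟩ ⟨t, ht, hνj⟩
      refine ⟨fun i => ?_, t * N, mul_ne_zero ht hN0, fun v hv => ?_⟩
      · rcases eq_or_ne i j with rfl | hij
        · rw [Function.update_self]
          exact Submodule.sum_mem _ fun i _ => Submodule.smul_mem _ _ (heM i)
        · rw [Function.update_of_ne hij]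
          exact heM i
      · rw [mul_smul]
        refine zsmul_mem_span_of_forall (fun i => ?_) (hN v hv)
        rcases eq_or_ne i j with rfl | hij
        · have := smul_mem_span_range_update e ν i
          have ht : ν i = t • (1 : MonoidAlgebra ℤ G) := by
            rw [hνj, one_def, smul_single, smul_eq_mul, mul_one]
          rwa [ht, smul_assoc, one_smul] at this
        · rw [← Function.update_of_ne hij (∑ i, ν i • e i) e]
          have : e i ∈ Submodule.span (MonoidAlgebra ℤ G)
              (Set.range (Function.update e j (∑ i, ν i • e i))) :=
            Submodule.subset_span ⟨i, Function.update_of_ne hij _ _⟩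
          rw [Function.update_of_ne hij]
          exact zsmul_mem this t)
    a ⟨fun i => ha ▸ Submodule.subset_span ⟨i, rfl⟩, 1, one_ne_zero,
      fun v hv => by rwa [one_smul, ha]⟩
  -- Induction on the prime factors of `N`; at `N = 1` the family is a basis of `M`.
  suffices main : ∀ (N : ℕ), N ≠ 0 → ∀ b : {i // e i ≠ 0} → α →₀ MonoidAlgebra ℤ G,
      LinearIndependent (MonoidAlgebra ℤ G) b → (∀ i, b i ∈ M) →
      (∀ v ∈ M, (N : ℤ) • v ∈ Submodule.span (MonoidAlgebra ℤ G) (Set.range b)) →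
      Module.Free (MonoidAlgebra ℤ G) M by
    refine main N.natAbs (Int.natAbs_ne_zero.2 hN0) _ hli (fun i => heM i) fun v hv => ?_
    have h1 : Submodule.span (MonoidAlgebra ℤ G) (Set.range e) ≤
        Submodule.span (MonoidAlgebra ℤ G) (Set.range fun i : {i // e i ≠ 0} => e i) := by
      rw [Submodule.span_le]
      rintro _ ⟨i, rfl⟩
      by_cases h0 : e i = 0
      · rw [h0]; exact Submodule.zero_mem _
      · exact Submodule.subset_span ⟨⟨i, h0⟩, rfl⟩
    rcases Int.natAbs_eq N with h2 | h2
    · rw [← h2]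
      exact h1 (hN v hv)
    · rw [eq_neg_iff_add_eq_zero, add_comm, ← eq_neg_iff_add_eq_zero] at h2
      rw [h2, neg_smul]
      exact Submodule.neg_mem _ (h1 (hN v hv))
  intro N
  induction N using induction_on_primes with
  | zero => intro h0; exact absurd rfl h0
  | one =>
    intro _ b hb hbM hN
    have : Submodule.span (MonoidAlgebra ℤ G) (Set.range b) = M := by
      refine le_antisymm (Submodule.span_le.2 ?_) fun v hv => by simpa using hN v hv
      rintro _ ⟨i, rfl⟩
      exact hbM i
    rw [← this]
    exact Module.Free.of_basis (Module.Basis.span hb)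
  | prime_mul p N hp ih =>
    intro h0 b hb hbM hN
    obtain ⟨b', h1, h2, h3⟩ := exists_linearIndependent_of_prime_mul h hδ
      ((Fintype.card_subtype_le _).trans (Fintype.card_fin n).le) hG M hpure hp N b hb hbM hN
    exact ih (right_ne_zero_of_mul h0) b' h1 h2 h3

end Integral

/-! ### Fox calculus and the start of the resolution -/

section FoxCalculus

open MonoidAlgebra

variable {G : Type*} [Group G] {α : Type*} {Q Q' : Type*} [AddCommGroup Q]
  [Module (MonoidAlgebra ℤ G) Q] [AddCommGroup Q'] [Module (MonoidAlgebra ℤ G) Q']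

lemma of_mul_smul (g g' : G) (v : Q) : of ℤ G (g * g') • v = of ℤ G g • of ℤ G g' • v := by
  rw [map_mul, mul_smul]

/-- The affine transformation `v ↦ g v + q` of a `ℤ[G]`-module. -/
noncomputable def affinePerm (g : G) (q : Q) : Equiv.Perm Q where
  toFun v := of ℤ G g • v + q
  invFun v := of ℤ G g⁻¹ • (v - q)
  left_inv v := by
    beta_reduce
    rw [add_sub_cancel_right, ← of_mul_smul, inv_mul_cancel, map_one, one_smul]
  right_inv v := by
    beta_reduce
    rw [← of_mul_smul, mul_inv_cancel, map_one, one_smul, sub_add_cancel]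

variable (π : FreeGroup α →* G)

/-- The action of a free group on a `ℤ[G]`-module by affine transformations in which the
generators `x` act by `v ↦ x v + q x`. -/
noncomputable def affineAction (q : α → Q) : FreeGroup α →* Equiv.Perm Q :=
  FreeGroup.lift fun x => affinePerm (π (FreeGroup.of x)) (q x)

/-- The derivation on a free group with given values on the generators. -/
noncomputable def foxDerivation (q : α → Q) (w : FreeGroup α) : Q := affineAction π q w 0

variable {π}

lemma foxDerivation_of (q : α → Q) (x : α) : foxDerivation π q (FreeGroup.of x) = q x := by
  simp [foxDerivation, affineAction, affinePerm]

/-- Differences do not see translation parts, so the linear part can be found by induction on the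
word alone. -/
lemma affineAction_apply (q : α → Q) (w : FreeGroup α) (v : Q) :
    affineAction π q w v = of ℤ G (π w) • v + foxDerivation π q w := by
  suffices hw : ∀ v v', affineAction π q w v - affineAction π q w v' =
      of ℤ G (π w) • (v - v') by
    rw [← sub_eq_iff_eq_add, foxDerivation, hw, sub_zero]
  induction w using FreeGroup.induction_on with
  | C1 => intro v v'; rw [map_one, map_one, map_one, one_smul]; rfl
  | of x =>
    intro v v'
    have : affineAction π q (FreeGroup.of x) = affinePerm (π (FreeGroup.of x)) (q x) :=
      FreeGroup.lift_apply_of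
    rw [this, smul_sub]
    exact add_sub_add_right_eq_sub ..
  | inv_of x hx =>
    intro v v'
    have hs : ∀ (σ : Equiv.Perm Q) v, σ (σ⁻¹ v) = v := fun σ => Equiv.apply_symm_apply σ
    have := hx ((affineAction π q (FreeGroup.of x))⁻¹ v) ((affineAction π q (FreeGroup.of x))⁻¹ v')
    rw [hs, hs] at this
    rw [this, map_inv, map_inv, ← of_mul_smul, inv_mul_cancel, map_one, one_smul]
  | mul w w' hw hw' =>
    intro v v'
    rw [map_mul, Equiv.Perm.mul_apply, Equiv.Perm.mul_apply, hw, hw', map_mul, of_mul_smul]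

/-- The product rule is composition of affine maps, evaluated at the origin. -/
lemma foxDerivation_mul (q : α → Q) (w w' : FreeGroup α) :
    foxDerivation π q (w * w') = of ℤ G (π w) • foxDerivation π q w' + foxDerivation π q w := by
  rw [← affineAction_apply, foxDerivation, foxDerivation, map_mul, Equiv.Perm.mul_apply]

lemma foxDerivation_one (q : α → Q) : foxDerivation π q 1 = 0 := by
  rw [foxDerivation, map_one]; rfl

lemma foxDerivation_inv (q : α → Q) (w : FreeGroup α) :
    foxDerivation π q w⁻¹ = - of ℤ G (π w)⁻¹ • foxDerivation π q w := by
  have := foxDerivation_mul (π := π) q w⁻¹ w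
  rw [inv_mul_cancel, foxDerivation_one, map_inv] at this
  rw [neg_smul]
  exact eq_neg_of_add_eq_zero_right this.symm

lemma map_foxDerivation (T : Q →ₗ[MonoidAlgebra ℤ G] Q') (q : α → Q) (w : FreeGroup α) :
    T (foxDerivation π q w) = foxDerivation π (fun x => T (q x)) w := by
  induction w using FreeGroup.induction_on with
  | C1 => rw [foxDerivation_one, foxDerivation_one, map_zero]
  | of x => rw [foxDerivation_of, foxDerivation_of]
  | inv_of x hx => rw [foxDerivation_inv, foxDerivation_inv, map_smul, hx]
  | mul w w' hw hw' => rw [foxDerivation_mul, foxDerivation_mul, map_add, map_smul, hw, hw']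

lemma foxDerivation_of_sub_one (w : FreeGroup α) :
    foxDerivation π (fun x => of ℤ G (π (FreeGroup.of x)) - 1) w = of ℤ G (π w) - 1 := by
  induction w using FreeGroup.induction_on with
  | C1 => rw [foxDerivation_one, map_one, map_one, sub_self]
  | of x => rw [foxDerivation_of]
  | inv_of x hx =>
    rw [foxDerivation_inv, hx, map_inv π, smul_eq_mul, mul_sub, mul_one, neg_mul, ← map_mul,
      inv_mul_cancel, map_one]
    abel
  | mul w w' hw hw' =>
    rw [foxDerivation_mul, hw, hw', map_mul, map_mul, smul_eq_mul, mul_sub, mul_one]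
    abel

variable (π) in
/-- The first boundary map of the resolution given by a presentation. -/
noncomputable def foxBoundary : (α →₀ MonoidAlgebra ℤ G) →ₗ[MonoidAlgebra ℤ G] MonoidAlgebra ℤ G :=
  Finsupp.linearCombination (MonoidAlgebra ℤ G) fun x => of ℤ G (π (FreeGroup.of x)) - 1

lemma foxBoundary_single (x : α) (c : MonoidAlgebra ℤ G) :
    foxBoundary π (Finsupp.single x c) = c * (of ℤ G (π (FreeGroup.of x)) - 1) := by
  rw [foxBoundary, Finsupp.linearCombination_single, smul_eq_mul]

/-- The fundamental formula of Fox calculus: the boundary turns the universal derivation into `w ↦ π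
w - 1`. -/
lemma foxBoundary_foxDerivation (w : FreeGroup α) :
    foxBoundary π (foxDerivation π (fun x => Finsupp.single x (1 : MonoidAlgebra ℤ G)) w) = of ℤ G (π w) - 1 := by
  rw [map_foxDerivation, ← foxDerivation_of_sub_one]
  simp only [foxBoundary_single, one_mul]

/-- The kernel of the first boundary map is generated by the Fox derivatives of the relators. -/
theorem ker_foxBoundary {β : Type*} (hπ : Function.Surjective π) (r : β → FreeGroup α)
    (hr : π.ker = Subgroup.normalClosure (Set.range r)) :
    LinearMap.ker (foxBoundary π) = Submodule.span (MonoidAlgebra ℤ G)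
      (Set.range fun i => foxDerivation π (fun x => Finsupp.single x (1 : MonoidAlgebra ℤ G)) (r i)) := by
  have hri : ∀ i, π (r i) = 1 := fun i => by
    rw [← MonoidHom.mem_ker, hr]; exact Subgroup.subset_normalClosure ⟨i, rfl⟩
  refine le_antisymm (fun v hv => ?_) (Submodule.span_le.2 ?_)
  · set N := Submodule.span (MonoidAlgebra ℤ G)
      (Set.range fun i => foxDerivation π (fun x => Finsupp.single x (1 : MonoidAlgebra ℤ G)) (r i)) with hN
    set q : α → (α →₀ MonoidAlgebra ℤ G) ⧸ N := fun x => N.mkQ (Finsupp.single x (1 : MonoidAlgebra ℤ G)) with hq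
    -- A relator has linear part one, and its translation part is a generator of `N`, so it acts
    -- trivially on the quotient.
    have hker : π.ker ≤ (affineAction π q).ker := by
      rw [hr]
      refine Subgroup.normalClosure_le_normal ?_
      rintro _ ⟨i, rfl⟩
      rw [SetLike.mem_coe, MonoidHom.mem_ker]
      ext1 v
      rw [affineAction_apply, hri, map_one, one_smul, hq, ← map_foxDerivation,
        Submodule.mkQ_apply, (Submodule.Quotient.mk_eq_zero N).2 (Submodule.subset_span ⟨i, rfl⟩),
        add_zero]
      rfl
    -- The derivation with values in the quotient descends to `G`, since it depends only on the
    -- affine action.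
    let D : G → (α →₀ MonoidAlgebra ℤ G) ⧸ N := fun g =>
      foxDerivation π q (Function.surjInv hπ g)
    have hD : ∀ w, D (π w) = foxDerivation π q w := by
      intro w
      have h1 : (Function.surjInv hπ (π w))⁻¹ * w ∈ π.ker := by
        rw [MonoidHom.mem_ker, map_mul, map_inv, Function.surjInv_eq hπ, inv_mul_cancel]
      have h2 := hker h1
      rw [MonoidHom.mem_ker, map_mul, map_inv, inv_mul_eq_one] at h2
      simp only [D, foxDerivation, h2]
    have hDmul : ∀ g x, D (g * π (FreeGroup.of x)) = of ℤ G g • q x + D g := by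
      intro g x
      obtain ⟨w, rfl⟩ := hπ g
      rw [← map_mul, hD, hD, foxDerivation_mul, foxDerivation_of]
    let T : MonoidAlgebra ℤ G →+ (α →₀ MonoidAlgebra ℤ G) ⧸ N :=
      (Finsupp.liftAddHom fun g => (zmultiplesHom _ (D g))).comp coeffAddEquiv.toAddMonoidHom
    have hT : ∀ g t, T (single g t) = t • D g := by
      intro g t
      simp [T]
    -- `T` recovers `v` modulo `N` from its boundary, because `D (g * x) - D g = g • q x`. Hence
    -- cycles lie in `N`.
    have hTd : ∀ v, T (foxBoundary π v) = N.mkQ v := by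
      intro v
      induction v using Finsupp.induction_linear with
      | zero => simp
      | add v v' h h' => simp only [map_add, h, h']
      | single x c =>
        induction c using MonoidAlgebra.induction_linear with
        | zero => simp
        | add c c' h h' => simp only [Finsupp.single_add, map_add, h, h']
        | single g t =>
          have h1 : (single g t : MonoidAlgebra ℤ G) = t • of ℤ G g := by
            rw [of_apply, smul_single, smul_eq_mul, mul_one]
          have h2 : (Finsupp.single x (single g t) : α →₀ MonoidAlgebra ℤ G) =
              t • of ℤ G g • Finsupp.single x 1 := by
            rw [Finsupp.smul_single, Finsupp.smul_single, smul_eq_mul, mul_one, h1]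
          rw [foxBoundary_single, mul_sub, mul_one, of_apply, single_mul_single, mul_one, map_sub,
            hT, hT, hDmul, smul_add, add_sub_cancel_right, h2, map_zsmul, map_smul]
    have := hTd v
    rw [LinearMap.mem_ker.1 hv, map_zero] at this
    exact (Submodule.Quotient.mk_eq_zero N).1 this.symm
  · rintro _ ⟨i, rfl⟩
    rw [SetLike.mem_coe, LinearMap.mem_ker, foxBoundary_foxDerivation, hri, map_one, sub_self]

variable (G) in
/-- The augmentation of the integral group ring. -/
noncomputable def augmentation :
    MonoidAlgebra ℤ G →ₗ[MonoidAlgebra ℤ G] (Representation.trivial ℤ G ℤ).asModule :=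
  LinearMap.toSpanSingleton _ _ ((Representation.trivial ℤ G ℤ).asModuleEquiv.symm 1)

lemma augmentation_single (g : G) (t : ℤ) :
    augmentation G (single g t) = (Representation.trivial ℤ G ℤ).asModuleEquiv.symm t := by
  rw [augmentation, LinearMap.toSpanSingleton_apply, Representation.single_smul]
  change t * 1 = t
  rw [mul_one]

lemma augmentation_surjective : Function.Surjective (augmentation G) := fun t =>
  ⟨single 1 t, augmentation_single 1 t⟩

lemma augmentation_foxBoundary (v : α →₀ MonoidAlgebra ℤ G) :
    augmentation G (foxBoundary π v) = 0 := by
  suffices h : (augmentation G).comp (foxBoundary π) = 0 from LinearMap.congr_fun h v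
  refine Finsupp.lhom_ext fun x c => ?_
  rw [LinearMap.comp_apply, foxBoundary_single, ← smul_eq_mul, map_smul, map_sub, one_def,
    of_apply, augmentation_single, augmentation_single, sub_self, smul_zero, LinearMap.zero_apply]

lemma exact_foxBoundary_augmentation (hπ : Function.Surjective π) :
    Function.Exact (foxBoundary π) (augmentation G) := by
  refine LinearMap.exact_iff.2 (le_antisymm (fun c hc => ?_) ?_)
  · have hgen : ∀ g t, single g t - single 1 t ∈ LinearMap.range (foxBoundary π) := by
      intro g t
      obtain ⟨w, rfl⟩ := hπ g
      have h1 : (single (π w) t - single 1 t : MonoidAlgebra ℤ G) =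
          t • (of ℤ G (π w) - 1) := by
        rw [smul_sub, of_apply, one_def, smul_single, smul_single, smul_eq_mul, mul_one]
      rw [h1, ← foxBoundary_foxDerivation, ← map_zsmul]
      exact ⟨_, rfl⟩
    -- Modulo boundaries every element is an integer, which the augmentation detects.
    have hdec : ∀ c, ∃ t, c - single 1 t ∈ LinearMap.range (foxBoundary π) := by
      intro c
      induction c using MonoidAlgebra.induction_linear with
      | zero => exact ⟨0, by simp⟩
      | add c c' h h' =>
        obtain ⟨t, ht⟩ := h
        obtain ⟨t', ht'⟩ := h'
        refine ⟨t + t', ?_⟩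
        rw [single_add, add_sub_add_comm]
        exact Submodule.add_mem _ ht ht'
      | single g t => exact ⟨t, hgen g t⟩
    obtain ⟨t, ht⟩ := hdec c
    obtain ⟨v, hv⟩ := id ht
    have h1 := augmentation_foxBoundary (π := π) v
    rw [hv, map_sub, LinearMap.mem_ker.1 hc, augmentation_single, zero_sub, neg_eq_zero,
      LinearEquiv.map_eq_zero_iff] at h1
    rwa [h1, single_zero, sub_zero] at ht
  · rintro _ ⟨v, rfl⟩
    exact augmentation_foxBoundary v

end FoxCalculus

/-! ### The resolution of length two -/

section Resolution

variable {G : Type u} [Group G] {α : Type u} {π : FreeGroup α →* G}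

/-- The modules of the resolution `0 → ker ∂ → ℤ[G]^α → ℤ[G]`. -/
def foxModule (π : FreeGroup α →* G) : ℕ → Type u
  | 0 => MonoidAlgebra ℤ G
  | 1 => α →₀ MonoidAlgebra ℤ G
  | 2 => LinearMap.ker (foxBoundary π)
  | _ + 3 => PUnit

noncomputable instance (k : ℕ) : AddCommGroup (foxModule π k) :=
  match k with
  | 0 => inferInstanceAs (AddCommGroup (MonoidAlgebra ℤ G))
  | 1 => inferInstanceAs (AddCommGroup (α →₀ MonoidAlgebra ℤ G))
  | 2 => inferInstanceAs (AddCommGroup (LinearMap.ker (foxBoundary π)))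
  | _ + 3 => inferInstanceAs (AddCommGroup PUnit.{u + 1})

noncomputable instance (k : ℕ) : Module (MonoidAlgebra ℤ G) (foxModule π k) :=
  match k with
  | 0 => inferInstanceAs (Module (MonoidAlgebra ℤ G) (MonoidAlgebra ℤ G))
  | 1 => inferInstanceAs (Module (MonoidAlgebra ℤ G) (α →₀ MonoidAlgebra ℤ G))
  | 2 => inferInstanceAs (Module (MonoidAlgebra ℤ G) (LinearMap.ker (foxBoundary π)))
  | _ + 3 => inferInstanceAs (Module (MonoidAlgebra ℤ G) PUnit.{u + 1})

/-- The boundary maps of the resolution `0 → ker ∂ → ℤ[G]^α → ℤ[G]`. -/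
noncomputable def foxComplexBoundary (π : FreeGroup α →* G) :
    ∀ k, foxModule π (k + 1) →ₗ[MonoidAlgebra ℤ G] foxModule π k
  | 0 => foxBoundary π
  | 1 => (LinearMap.ker (foxBoundary π)).subtype
  | _ + 2 => 0

/-- If the kernel of the first boundary map is free, then it completes a free resolution of
length two. -/
noncomputable def foxResolution (hπ : Function.Surjective π)
    (hfree : Module.Free (MonoidAlgebra ℤ G) (LinearMap.ker (foxBoundary π))) :
    FreeResolution G 2 where
  F := foxModule π
  free k :=
    match k with
    | 0 => inferInstanceAs (Module.Free (MonoidAlgebra ℤ G) (MonoidAlgebra ℤ G))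
    | 1 => inferInstanceAs (Module.Free (MonoidAlgebra ℤ G) (α →₀ MonoidAlgebra ℤ G))
    | 2 => hfree
    | _ + 3 => inferInstanceAs (Module.Free (MonoidAlgebra ℤ G) PUnit.{u + 1})
  bd := foxComplexBoundary π
  aug := augmentation G
  aug_surjective := augmentation_surjective
  exact_zero := exact_foxBoundary_augmentation hπ
  exact_succ k :=
    match k with
    | 0 => (foxBoundary π).exact_subtype_ker_map
    | 1 => fun v => ⟨fun hv => ⟨0, Subtype.ext (Eq.symm hv)⟩, by
        rintro ⟨c, rfl⟩
        exact map_zero _⟩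
    | _ + 2 => fun v => ⟨fun _ => ⟨0, Subsingleton.elim (α := PUnit) _ _⟩, fun _ => rfl⟩
  length_le k hk :=
    match k, hk with
    | _ + 3, _ => inferInstanceAs (Subsingleton PUnit.{u + 1})

end Resolution

/-! ### Unpacking the hypotheses -/

lemma IsRelatorGroup.exists_freeGroupHom {n : ℕ} {G : Type u} [Group G] (h : IsRelatorGroup n G) :
    ∃ (α : Type u) (π : FreeGroup α →* G) (r : Fin n → FreeGroup α), Function.Surjective π ∧
      π.ker = Subgroup.normalClosure (Set.range r) := by
  obtain ⟨α, r, ⟨e⟩⟩ := h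
  refine ⟨α, e.symm.toMonoidHom.comp (PresentedGroup.mk _), r,
    e.symm.surjective.comp (QuotientGroup.mk'_surjective _), ?_⟩
  ext w
  rw [MonoidHom.mem_ker, ← PresentedGroup.mk_eq_one_iff]
  exact e.symm.map_eq_one_iff

/-- Enlarging `δ`, one can assume that it is positive. -/
lemma HypothesisH.exists_pos {n : ℕ} {δ : ℝ} {G : Type u} [Group G]
    (h : HypothesisH.{u, w} n δ G) :
    ∃ (δ' : ℝ) (X : Type w) (_ : MetricSpace X) (_ : Nonempty X) (_ : MulAction G X),
      0 < δ' ∧ IsIsometricSMul G X ∧ IsHyperbolic δ' X ∧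
        ∀ g : G, g ≠ 1 → ∀ p : X, (2 * (n : ℝ) + 11) ^ 2 * δ' < dist (g • p) p := by
  obtain ⟨hδ, X, _, hne, _, hiso, hX, hlt⟩ := h
  -- The strict inequality leaves room for a real `t`, from which the new `δ` is obtained by
  -- division. It is positive even if `δ = 0`, as counting radii in units of `δ` requires.
  obtain ⟨t, ht, hδt, htd⟩ := ENNReal.lt_iff_exists_real_btwn.1 hlt
  have hn : 0 < (2 * (n : ℝ) + 11) ^ 2 := by positivity
  have hlt' : (2 * (n : ℝ) + 11) ^ 2 * δ < t := (ENNReal.ofReal_lt_ofReal_iff_of_nonneg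
    (by positivity)).1 hδt
  have ht' : δ < t / (2 * (n : ℝ) + 11) ^ 2 := by rwa [lt_div_iff₀' hn]
  refine ⟨t / (2 * (n : ℝ) + 11) ^ 2, X, _, hne, _, hδ.trans_lt ht', hiso, hX.mono ht'.le,
    fun g hg p => ?_⟩
  rw [mul_div_cancel₀ _ hn.ne']
  have h1 : displacement G X ≤ edist (g • p) p := iInf₂_le_of_le g hg (iInf_le _ p)
  have h2 := htd.trans_le h1
  rw [edist_dist] at h2
  exact (ENNReal.ofReal_lt_ofReal_iff_of_nonneg ht).1 h2

end FewRelator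

theorem theorem1p9 (n : ℕ) (δ : ℝ) (G : Type u) [Group G]
    (hrel : FewRelator.IsRelatorGroup n G)
    (hH : FewRelator.HypothesisH.{u, w} n δ G) :
    FewRelator.cohomologicalDimension G ≤ 2 := by
  obtain ⟨α, π, r, hπ, hr⟩ := hrel.exists_freeGroupHom
  obtain ⟨δ', X, _, _, _, hδ, _, hX, hG⟩ := hH.exists_pos
  have hfree : Module.Free (MonoidAlgebra ℤ G) (LinearMap.ker (FewRelator.foxBoundary π)) := by
    refine FewRelator.free_of_pure hX hδ (n := n) (fun g hg p => lt_of_le_of_lt ?_ (hG g hg p)) _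
      (fun t v ht hv => ?_) _ (FewRelator.ker_foxBoundary hπ r hr).symm
    -- The separation constant `4 * n ^ 2 + 16 * n + 10` is at most `(2 * n + 11) ^ 2`.
    · exact mul_le_mul_of_nonneg_right (by nlinarith [(n.cast_nonneg : (0 : ℝ) ≤ n)]) hδ.le
    · rw [LinearMap.mem_ker, map_zsmul] at hv
      exact FewRelator.zsmul_cancel ht hv
  exact iInf₂_le 2 ⟨FewRelator.foxResolution hπ hfree⟩
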